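/- Let $\Bbbk$ be a field of characteristic zero and let $\mathfrak g=\bigoplus_{n\in\mathbb Z}\mathfrak g_n$ be a $\mathbb Z$-graded Lie algebra over $\Bbbk$, that is, $[\mathfrak g_n,\mathfrak g_m]\subseteq\mathfrak g_{n+m}$ for all $n,m$, with every $\mathfrak g_n$ finite-dimensional. Let $\mathfrak M$ be a $\Bbbk$-basis of $\mathfrak g$ consisting of homogeneous elements, with a total order $<$ compatible with the grading (larger degree implies larger in $<$). Write $\mathfrak M_+$ and $\mathfrak M_-$ for the sets of elements of $\mathfrak M$ of positive and negative degree, respectively. For nonzero $e\in\mathfrak g$ let $\ell_+(e)$ (respectively $\ell_-(e)$) be the largest (respectively smallest) element of $\mathfrak M$ appearing in $e$ when $e$ is written as a linear combination of elements of $\mathfrak M$, and put $\ell_\pm(0)=0$. For a nonempty finite tuple $\mathbf i=(M_1,\dots,M_n)$ of elements of $\mathfrak M_\pm$ and $M\in\mathfrak M$ put $$D^\pm_{\mathbf i}(M)=\ell_\pm\big([\cdots[[M,M_1],M_2],\cdots,M_n]\big).$$ For $M\in\mathfrak M$ let $\mathcal L_+(M)$ be the set of all elements of $\mathfrak M$ of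 the form $D^+_{\mathbf i}(M)$, with $\mathbf i$ a nonempty finite tuple from $\mathfrak M_+$, such that $D^+_{\mathbf i}(N)<D^+_{\mathbf i}(M)$ for all $N<M$ in $\mathfrak M$ with $D^+_{\mathbf i}(N)\neq 0$. Let $\mathcal L_-(M)$ be the set of all elements of $\mathfrak M$ of the form $D^-_{\mathbf i}(M)$, with $\mathbf i$ a nonempty finite tuple from $\mathfrak M_-$, such that $D^-_{\mathbf i}(N)>D^-_{\mathbf i}(M)$ for all $N>M$ in $\mathfrak M$ with $D^-_{\mathbf i}(N)\neq 0$. An infinite sequence $((M_i,N_i))_{i\ge 1}$ of distinct pairs of elements of $\mathfrak M$ with $M_i\le N_i$ is called leading-Dicksonian if $M_j\notin\mathcal L_-(M_i)$ and $N_j\notin\mathcal L_+(N_i)$ for all $i<j$. The graded Lie algebra $\mathfrak g$ is called Dicksonian if some ordered homogeneous basis $(\mathfrak M,<)$ as above admits no infinite leading-Dicksonian sequence. Equip the symmetric algebra $S(\mathfrak g)$ with its natural Poisson bracket, that is, the unique bracket $\{-,-\}$ that is a $\Bbbk$-linear derivation in each argument and satisfies $\{x,y\}=[x,y]$ for $x,y\in\mathfrak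 g$. An ideal $I$ of $S(\mathfrak g)$ is a Poisson ideal if $\{S(\mathfrak g),I\}\subseteq I$. **Theorem.** If $\mathfrak g$ is Dicksonian, then $S(\mathfrak g)$ satisfies the ascending chain condition on radical Poisson ideals: every ascending sequence $I_0\subseteq I_1\subseteq I_2\subseteq\cdots$ of radical Poisson ideals of $S(\mathfrak g)$ is eventually constant. -/

import Mathlib

noncomputable section

/-! ### The Poisson bracket of a symmetric algebra -/

namespace SymmetricAlgebra

section Derivations

variable {R : Type*} {M : Type*} {N : Type*} [CommRing R] [AddCommGroup M] [Module R M]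
  [AddCommGroup N] [Module R N] [Module (SymmetricAlgebra R M) N]

/-- Two derivations of a symmetric algebra which agree on the generating module are equal. -/
theorem derivation_ext {D E : Derivation R (SymmetricAlgebra R M) N}
    (h : ∀ x, D (ι R M x) = E (ι R M x)) : D = E := by
  ext a
  induction a using SymmetricAlgebra.induction with
  | algebraMap r => simp
  | ι x => exact h x
  | mul a b ha hb => simp [Derivation.leibniz, ha, hb]
  | add a b ha hb => simp [ha, hb]

variable [IsScalarTower R (SymmetricAlgebra R M) N]

/-- Every linear map from `M` to an `S(M)`-module is the restriction of a derivation of `S(M)`. -/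
theorem exists_derivation (f : M →ₗ[R] N) :
    ∃ D : Derivation R (SymmetricAlgebra R M) N, ∀ x, D (ι R M x) = f x := by
  let _ : Module (SymmetricAlgebra R M)ᵐᵒᵖ N :=
    Module.compHom N ((RingHom.id (SymmetricAlgebra R M)).fromOpposite fun _ _ => mul_comm _ _)
  have : IsCentralScalar (SymmetricAlgebra R M) N := ⟨fun _ _ => rfl⟩
  have : IsScalarTower R (SymmetricAlgebra R M)ᵐᵒᵖ N :=
    ⟨fun r a n => smul_assoc r a.unop n⟩
  let F : SymmetricAlgebra R M →ₐ[R] TrivSqZeroExt (SymmetricAlgebra R M) N :=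
    lift ((TrivSqZeroExt.inlAlgHom R (SymmetricAlgebra R M) N).toLinearMap ∘ₗ ι R M +
      (TrivSqZeroExt.inrHom (SymmetricAlgebra R M) N).restrictScalars R ∘ₗ f)
  have hF : (TrivSqZeroExt.fstHom R (SymmetricAlgebra R M) N).comp F = AlgHom.id R _ := by
    apply algHom_ext
    ext x
    simp [F]
  have hfst : ∀ a, (F a).fst = a := fun a => DFunLike.congr_fun hF a
  refine ⟨⟨⟨⟨fun a => (F a).snd, fun a b => by simp⟩, fun r a => by simp⟩, by simp, fun a b => ?_⟩,
    fun x => ?_⟩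
  · simp [hfst]
  · change (F (ι R M x)).snd = f x
    simp [F]

/-- The unique derivation of the symmetric algebra `S(M)` with values in an `S(M)`-module `N`
extending a given linear map `M → N`. -/
def extendDerivation : (M →ₗ[R] N) →ₗ[R] Derivation R (SymmetricAlgebra R M) N where
  toFun f := (exists_derivation f).choose
  map_add' f g := derivation_ext fun x => by
    rw [Derivation.add_apply, (exists_derivation _).choose_spec, (exists_derivation f).choose_spec,
      (exists_derivation g).choose_spec, LinearMap.add_apply]
  map_smul' r f := derivation_ext fun x => by
    rw [RingHom.id_apply, Derivation.smul_apply, (exists_derivation _).choose_spec,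
      (exists_derivation f).choose_spec, LinearMap.smul_apply]

@[simp]
theorem extendDerivation_ι (f : M →ₗ[R] N) (x : M) : extendDerivation f (ι R M x) = f x :=
  (exists_derivation f).choose_spec x

end Derivations

section Poisson

variable {k : Type*} {L : Type*} [CommRing k] [LieRing L] [LieAlgebra k L]

variable (k L) in
/-- The natural Poisson bracket `{a, b} = poissonBracket k L a b` of the symmetric algebra of a Lie
algebra: the unique map which is a derivation in each of its two arguments and satisfies
`{x, y} = ⁅x, y⁆` for `x`, `y` in the Lie algebra. -/
def poissonBracket : Derivation k (SymmetricAlgebra k L)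
    (Derivation k (SymmetricAlgebra k L) (SymmetricAlgebra k L)) :=
  extendDerivation (extendDerivation ∘ₗ
    LinearMap.compRight k (ι k L) ∘ₗ (LieModule.toEnd k L L : L →ₗ[k] L →ₗ[k] L))

@[simp]
theorem poissonBracket_ι_ι (x y : L) :
    poissonBracket k L (ι k L x) (ι k L y) = ι k L ⁅x, y⁆ := by
  simp [poissonBracket]

theorem poissonBracket_skew (a b : SymmetricAlgebra k L) :
    poissonBracket k L a b = -poissonBracket k L b a := by
  induction a using SymmetricAlgebra.induction with
  | algebraMap r => simp
  | add a a' ha ha' => simp [ha, ha']; ring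
  | mul a a' ha ha' => simp [ha, ha']; ring
  | ι x =>
    induction b using SymmetricAlgebra.induction with
    | algebraMap r => simp
    | add b b' hb hb' => simp [hb, hb']; ring
    | mul b b' hb hb' => simp [hb, hb']; ring
    | ι y => rw [poissonBracket_ι_ι, poissonBracket_ι_ι, ← map_neg, lie_skew]

theorem poissonBracket_jacobi (a b c : SymmetricAlgebra k L) :
    poissonBracket k L a (poissonBracket k L b c) =
      poissonBracket k L (poissonBracket k L a b) c +
        poissonBracket k L b (poissonBracket k L a c) := by
  induction a using SymmetricAlgebra.induction with
  | algebraMap r => simp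
  | add a a' ha ha' => simp [ha, ha']; ring
  | mul a a' ha ha' =>
    simp [ha, ha', poissonBracket_skew b a, poissonBracket_skew b a']; ring
  | ι x =>
    induction b using SymmetricAlgebra.induction with
    | algebraMap r => simp
    | add b b' hb hb' => simp [hb, hb']; ring
    | mul b b' hb hb' => simp [hb, hb']; ring
    | ι y =>
      induction c using SymmetricAlgebra.induction with
      | algebraMap r => simp
      | add b b' hb hb' => simp [hb, hb']; ring
      | mul b b' hb hb' => simp [hb, hb']; ring
      | ι z => simp only [poissonBracket_ι_ι, ← map_add]; rw [leibniz_lie]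

variable (k L) in
/-- An ideal `I` of `S(L)` is a Poisson ideal if `{S(L), I} ⊆ I`. -/
def IsPoissonIdeal (I : Ideal (SymmetricAlgebra k L)) : Prop :=
  ∀ a, ∀ f ∈ I, poissonBracket k L a f ∈ I

variable (k L) in
/-- The ascending chain condition on radical Poisson ideals of `S(L)`: every ascending sequence of
such ideals is eventually constant. -/
def ACCRadicalPoissonIdeals : Prop :=
  ∀ I : ℕ → Ideal (SymmetricAlgebra k L), Monotone I →
    (∀ n, (I n).IsRadical ∧ IsPoissonIdeal k L (I n)) → ∃ n, ∀ m, n ≤ m → I m = I n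

end Poisson

end SymmetricAlgebra

/-! ### Dicksonian graded Lie algebras -/

namespace Dicksonian

variable {k : Type*} {L : Type*} [Field k] [LieRing L] [LieAlgebra k L]
variable {ι : Type*} [LinearOrder ι]

/-- `b` is a basis of homogeneous elements whose total order (that of the index type) is compatible
with the grading: a basis element of larger degree is larger. -/
structure IsOrderedHomogeneous (𝒜 : ℤ → Submodule k L) (b : Module.Basis ι k L) : Prop where
  homogeneous : ∀ i, ∃ n, b i ∈ 𝒜 n
  lt_of_degree_lt : ∀ i j m n, b i ∈ 𝒜 m → b j ∈ 𝒜 n → m < n → i < j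

/-- The (indices of) basis elements of positive degree. -/
def positiveIndices (𝒜 : ℤ → Submodule k L) (b : Module.Basis ι k L) : Set ι :=
  {i | ∃ n, 0 < n ∧ b i ∈ 𝒜 n}

/-- The (indices of) basis elements of negative degree. -/
def negativeIndices (𝒜 : ℤ → Submodule k L) (b : Module.Basis ι k L) : Set ι :=
  {i | ∃ n, n < 0 ∧ b i ∈ 𝒜 n}

/-- The largest basis element appearing in `e`; it is `⊥` exactly when `e = 0`. -/
def upperLeader (b : Module.Basis ι k L) (e : L) : WithBot ι := (b.repr e).support.max

/-- The smallest basis element appearing in `e`; it is `⊤` exactly when `e = 0`. -/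
def lowerLeader (b : Module.Basis ι k L) (e : L) : WithTop ι := (b.repr e).support.min

/-- The iterated bracket `[[[M, M₁], M₂], …, Mₙ]` of basis elements, for `s = (M₁, …, Mₙ)`. -/
def iteratedBracket (b : Module.Basis ι k L) (s : List ι) (M : ι) : L :=
  s.foldl (fun e i => ⁅e, b i⁆) (b M)

/-- The operator `D⁺_s` on basis elements: the upper leader of the iterated bracket. -/
def upperD (b : Module.Basis ι k L) (s : List ι) (M : ι) : WithBot ι :=
  upperLeader b (iteratedBracket b s M)

/-- The operator `D⁻_s` on basis elements: the lower leader of the iterated bracket. -/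
def lowerD (b : Module.Basis ι k L) (s : List ι) (M : ι) : WithTop ι :=
  lowerLeader b (iteratedBracket b s M)

/-- The set `𝓛₊(M)` of the basis elements `D⁺_s(M)`, for `s` a nonempty tuple of basis elements of
positive degree, such that `D⁺_s(N) < D⁺_s(M)` for all `N < M` with `D⁺_s(N)` nonzero. -/
def upperLeadingSet (𝒜 : ℤ → Submodule k L) (b : Module.Basis ι k L) (M : ι) : Set ι :=
  {K | ∃ s : List ι, s ≠ [] ∧ (∀ i ∈ s, i ∈ positiveIndices 𝒜 b) ∧ upperD b s M = K ∧
    ∀ N < M, upperD b s N ≠ ⊥ → upperD b s N < upperD b s M}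

/-- The set `𝓛₋(M)` of the basis elements `D⁻_s(M)`, for `s` a nonempty tuple of basis elements of
negative degree, such that `D⁻_s(N) > D⁻_s(M)` for all `N > M` with `D⁻_s(N)` nonzero. -/
def lowerLeadingSet (𝒜 : ℤ → Submodule k L) (b : Module.Basis ι k L) (M : ι) : Set ι :=
  {K | ∃ s : List ι, s ≠ [] ∧ (∀ i ∈ s, i ∈ negativeIndices 𝒜 b) ∧ lowerD b s M = K ∧
    ∀ N, M < N → lowerD b s N ≠ ⊤ → lowerD b s M < lowerD b s N}

/-- An infinite sequence of distinct pairs `(Mᵢ, Nᵢ)` with `Mᵢ ≤ Nᵢ` is leading-Dicksonian if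
`Mⱼ ∉ 𝓛₋(Mᵢ)` and `Nⱼ ∉ 𝓛₊(Nᵢ)` for all `i < j`. -/
structure IsLeadingDicksonianSeq (𝒜 : ℤ → Submodule k L) (b : Module.Basis ι k L)
    (p : ℕ → ι × ι) : Prop where
  injective : Function.Injective p
  le : ∀ i, (p i).1 ≤ (p i).2
  notMem_lower : ∀ i j, i < j → (p j).1 ∉ lowerLeadingSet 𝒜 b (p i).1
  notMem_upper : ∀ i j, i < j → (p j).2 ∉ upperLeadingSet 𝒜 b (p i).2

end Dicksonian

/-- A Lie algebra graded by `𝒜` is Dicksonian if it has an ordered homogeneous basis, with order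
compatible with the grading, for which there is no infinite leading-Dicksonian sequence. -/
def IsDicksonian {k : Type*} {L : Type*} [Field k] [LieRing L] [LieAlgebra k L]
    (𝒜 : ℤ → Submodule k L) : Prop :=
  ∃ (s : Set L) (_ : LinearOrder s) (b : Module.Basis s k L),
    (∀ x : s, b x = x) ∧ Dicksonian.IsOrderedHomogeneous 𝒜 b ∧
      ¬ ∃ p : ℕ → s × s, Dicksonian.IsLeadingDicksonianSeq 𝒜 b p

end

/-! The proof adapts the Ritt–Raudenbush basis theorem of differential algebra.

On the polynomial ring in an ordered homogeneous basis, Poisson ideals are stable under the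
derivations `{·, M}` for basis elements `M`. If the chain condition fails, Zorn's lemma gives a
prime stable ideal `P` that is not the radical stable ideal of a finite set, but becomes so after
adding any `s ∉ P` (`StableIdeal.ascending_chain_condition`).

Because all degrees are finite-dimensional, intervals of basis elements are finite, and the basis
elements can be ranked by natural numbers from the inside out, so that the largest rank on an
interval is attained at an end (`exists_isConvexRanking`). Polynomials are compared by the largest
rank of a variable, then by the length of the interval their variables span, then by degree. One
builds finite sets `F₀ ⊆ F₁ ⊆ ⋯` in `P` by repeatedly taking a simplest `fₙ ∈ P` outside the radical
stable ideal of `Fₙ`, with smallest variable `Mₙ` and largest variable `Nₙ`, and adjoining finitely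
many elements that account for all elements of `P` in the variables from `Mₙ` to `Nₙ` (Hilbert's
basis theorem) and that, together with the product `sₙ` of the separants `∂fₙ/∂Mₙ` and `∂fₙ/∂Nₙ`,
generate a radical stable ideal containing `P`. In characteristic zero minimality implies `sₙ ∉ P`.

The pairs `(Mₙ, Nₙ)` are distinct, so they do not form a leading-Dicksonian sequence, and for some
`i < j` we have, say, `Nⱼ ∈ 𝓛₊(Nᵢ)`. Then an iterated bracket sends `fᵢ` to a polynomial with largest
variable `Nⱼ`, occurring linearly with coefficient a nonzero multiple of `∂fᵢ/∂Nᵢ`: the other terms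
of the Leibniz formula only involve variables of smaller degree
(`Dicksonian.upperProlongation_of_mem`). Eliminating `Nⱼ` from `fⱼ` leaves a simpler polynomial: the
new variables introduced below `Mⱼ` are harmless because the rank of `Mᵢ` is bounded by the largest
rank in `fⱼ`. Hence `sᵢ fⱼ`, and therefore `fⱼ ^ 2`, lies in the radical stable ideal of `Fⱼ`, a
contradiction. The case `Mⱼ ∈ 𝓛₋(Mᵢ)` is symmetric. -/

noncomputable section

open MvPolynomial

/-! ### Radical ideals stable under derivations -/

namespace StableIdeal

variable {k A σ : Type*} [CommRing k] [CommRing A] [Algebra k A]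

/-- An ideal is stable under a family of derivations if each of them maps it into itself. -/
def IsStable (δ : σ → Derivation k A A) (I : Ideal A) : Prop :=
  ∀ i, ∀ f ∈ I, δ i f ∈ I

/-- The smallest radical stable ideal containing a set. -/
def radicalClosure (δ : σ → Derivation k A A) (X : Set A) : Ideal A :=
  sInf {I | I.IsRadical ∧ IsStable δ I ∧ X ⊆ I}

variable {δ : σ → Derivation k A A} {X Y : Set A} {I J P : Ideal A}

theorem subset_radicalClosure : X ⊆ radicalClosure δ X := fun _ hx =>
  Submodule.mem_sInf.2 fun _ hI => hI.2.2 hx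

theorem radicalClosure_le (hr : I.IsRadical) (hs : IsStable δ I) (h : X ⊆ I) :
    radicalClosure δ X ≤ I :=
  sInf_le ⟨hr, hs, h⟩

theorem isRadical_radicalClosure : (radicalClosure δ X).IsRadical := by
  rintro x ⟨n, hx⟩
  exact Submodule.mem_sInf.2 fun I hI => hI.1 ⟨n, Submodule.mem_sInf.1 hx I hI⟩

theorem isStable_radicalClosure : IsStable δ (radicalClosure δ X) := fun i f hf =>
  Submodule.mem_sInf.2 fun I hI => hI.2.1 i f (Submodule.mem_sInf.1 hf I hI)

theorem radicalClosure_mono (h : X ⊆ Y) : radicalClosure δ X ≤ radicalClosure δ Y :=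
  radicalClosure_le isRadical_radicalClosure isStable_radicalClosure
    (h.trans subset_radicalClosure)

/-- The ideal quotient `(I : s)`. -/
def quotientBy (I : Ideal A) (s : A) : Ideal A := Submodule.comap (LinearMap.mulRight A s) I

theorem mem_quotientBy {s x : A} : x ∈ quotientBy I s ↔ x * s ∈ I := by
  simp [quotientBy]

theorem isRadical_quotientBy (hr : I.IsRadical) (s : A) : (quotientBy I s).IsRadical := by
  rintro x ⟨n, hx⟩
  rw [mem_quotientBy] at hx ⊢
  refine hr ⟨n + 1, ?_⟩
  have : (x * s) ^ (n + 1) = x * s ^ n * (x ^ n * s) := by ring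
  rw [this]
  exact I.mul_mem_left _ hx

/-- If `x * s ∈ I` then `(δ x * s) ^ 2` is a combination of `δ (x * s)` and `x * s`, so that it
lies in `I`; hence quotients of radical stable ideals are stable. -/
theorem isStable_quotientBy (hr : I.IsRadical) (hs : IsStable δ I) (s : A) :
    IsStable δ (quotientBy I s) := by
  intro i x hx
  rw [mem_quotientBy] at hx ⊢
  refine hr ⟨2, ?_⟩
  have : (δ i x * s) ^ 2 = δ i x * s * δ i (x * s) - δ i x * δ i s * (x * s) := by
    rw [Derivation.leibniz, smul_eq_mul, smul_eq_mul]
    ring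
  rw [this]
  exact I.sub_mem (I.mul_mem_left _ (hs i _ hx)) (I.mul_mem_left _ hx)

theorem mul_mem_of_mem_radicalClosure (hr : I.IsRadical) (hs : IsStable δ I)
    (h : ∀ x ∈ X, ∀ y ∈ Y, x * y ∈ I) {a b : A} (ha : a ∈ radicalClosure δ X)
    (hb : b ∈ radicalClosure δ Y) : a * b ∈ I := by
  have h1 : ∀ y ∈ Y, radicalClosure δ X ≤ quotientBy I y := fun y hy =>
    radicalClosure_le (isRadical_quotientBy hr y) (isStable_quotientBy hr hs y)
      fun x hx => mem_quotientBy.2 (h x hx y hy)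
  have h2 : radicalClosure δ Y ≤ quotientBy I a :=
    radicalClosure_le (isRadical_quotientBy hr a) (isStable_quotientBy hr hs a)
      fun y hy => mem_quotientBy.2 (mul_comm a y ▸ mem_quotientBy.1 (h1 y hy ha))
  exact mul_comm b a ▸ mem_quotientBy.1 (h2 hb)

theorem IsStable.sSup {c : Set (Ideal A)} (hne : c.Nonempty) (hc : DirectedOn (· ≤ ·) c)
    (h : ∀ J ∈ c, IsStable δ J) : IsStable δ (sSup c) := by
  intro i f hf
  obtain ⟨J, hJ, hf⟩ := (Submodule.mem_sSup_of_directed hne hc).1 hf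
  exact (Submodule.mem_sSup_of_directed hne hc).2 ⟨J, hJ, h J hJ i f hf⟩

theorem isRadical_sSup {c : Set (Ideal A)} (hne : c.Nonempty) (hc : DirectedOn (· ≤ ·) c)
    (h : ∀ J ∈ c, J.IsRadical) : (sSup c).IsRadical := by
  rintro f ⟨n, hf⟩
  obtain ⟨J, hJ, hf⟩ := (Submodule.mem_sSup_of_directed hne hc).1 hf
  exact (Submodule.mem_sSup_of_directed hne hc).2 ⟨J, hJ, h J hJ ⟨n, hf⟩⟩

theorem exists_finset_subset_of_subset_sSup {c : Set (Ideal A)} (hne : c.Nonempty)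
    (hc : DirectedOn (· ≤ ·) c) (F : Finset A) (hF : (F : Set A) ⊆ (sSup c : Ideal A)) :
    ∃ J ∈ c, (F : Set A) ⊆ J := by
  classical
  induction F using Finset.induction_on with
  | empty => obtain ⟨J, hJ⟩ := hne; exact ⟨J, hJ, by simp⟩
  | insert a F _ ih =>
    rw [Finset.coe_insert, Set.insert_subset_iff] at hF
    obtain ⟨J, hJ, h1⟩ := ih hF.2
    obtain ⟨J', hJ', h2⟩ := (Submodule.mem_sSup_of_directed hne hc).1 hF.1
    obtain ⟨K, hK, h3, h4⟩ := hc J hJ J' hJ'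
    refine ⟨K, hK, ?_⟩
    rw [Finset.coe_insert, Set.insert_subset_iff]
    exact ⟨h4 h2, h1.trans h3⟩

/-- An ideal which is not contained in the radical closure of any of its finite subsets. -/
def NotFinitelyGenerated (δ : σ → Derivation k A A) (P : Ideal A) : Prop :=
  ∀ F : Finset A, (F : Set A) ⊆ P → ¬ P ≤ radicalClosure δ (F : Set A)

theorem exists_finset_of_le_radicalClosure_insert {s : A}
    (hmax : ∀ J : Ideal A, J.IsRadical → IsStable δ J → NotFinitelyGenerated δ J → P ≤ J → J ≤ P)
    (hs : s ∉ P) :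
    ∃ F : Finset A, (F : Set A) ⊆ P ∧ P ≤ radicalClosure δ (insert s (F : Set A)) := by
  classical
  have h1 : ¬ NotFinitelyGenerated δ (radicalClosure δ (insert s (P : Set A))) := fun h =>
    hs (hmax _ isRadical_radicalClosure isStable_radicalClosure h
      ((Set.subset_insert _ _).trans subset_radicalClosure)
      (subset_radicalClosure (Set.mem_insert _ _)))
  simp only [NotFinitelyGenerated, not_forall, not_not] at h1
  obtain ⟨G, hG, hle⟩ := h1
  -- Each element of the closure of `P ∪ {s}` lies in the closure of a finite part, because the
  -- closures of the finite parts form a directed family.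
  let c : Set (Ideal A) := {J | ∃ F : Finset A, (F : Set A) ⊆ P ∧
    J = radicalClosure δ (insert s (F : Set A))}
  have hne : c.Nonempty := ⟨_, ∅, by simp, rfl⟩
  have hc : DirectedOn (· ≤ ·) c := by
    rintro _ ⟨F, hF, rfl⟩ _ ⟨F', hF', rfl⟩
    refine ⟨_, ⟨F ∪ F', by simp [hF, hF'], rfl⟩, radicalClosure_mono ?_, radicalClosure_mono ?_⟩ <;>
    exact Set.insert_subset_insert (by simp)
  have hGc : (G : Set A) ⊆ (sSup c : Ideal A) := by
    refine hG.trans (radicalClosure_le (isRadical_sSup hne hc ?_) (IsStable.sSup hne hc ?_) ?_)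
    · rintro _ ⟨F, hF, rfl⟩; exact isRadical_radicalClosure
    · rintro _ ⟨F, hF, rfl⟩; exact isStable_radicalClosure
    · refine Set.insert_subset_iff.2 ⟨?_, fun x hx => ?_⟩
      · have hmem : radicalClosure δ (insert s ((∅ : Finset A) : Set A)) ∈ c := ⟨∅, by simp, rfl⟩
        exact le_sSup hmem (subset_radicalClosure (Set.mem_insert _ _))
      · have hmem : radicalClosure δ (insert s (({x} : Finset A) : Set A)) ∈ c :=
          ⟨{x}, by simpa using hx, rfl⟩
        exact le_sSup hmem (subset_radicalClosure (by simp))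
  obtain ⟨_, ⟨F, hF, rfl⟩, hGF⟩ := exists_finset_subset_of_subset_sSup hne hc G hGc
  refine ⟨F, hF, ?_⟩
  exact ((Set.subset_insert s (P : Set A)).trans subset_radicalClosure : (P : Set A) ⊆ _).trans
    (hle.trans (radicalClosure_le isRadical_radicalClosure isStable_radicalClosure hGF))

/-- To prove the ascending chain condition for radical stable ideals it is enough to exclude prime
stable ideals `P` which are not finitely generated, but become finitely generated after adding any
element outside `P`. -/
theorem ascending_chain_condition
    (h : ∀ P : Ideal A, P.IsPrime → IsStable δ P → NotFinitelyGenerated δ P →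
      (∀ s ∉ P, ∃ F : Finset A, (F : Set A) ⊆ P ∧
        P ≤ radicalClosure δ (insert s (F : Set A))) → False)
    (I : ℕ → Ideal A) (hI : Monotone I) (hIr : ∀ n, (I n).IsRadical)
    (hIs : ∀ n, IsStable δ (I n)) : ∃ n, ∀ m, n ≤ m → I m = I n := by
  classical
  have hfg : ∀ J : Ideal A, J.IsRadical → IsStable δ J → ¬ NotFinitelyGenerated δ J := by
    intro J hJr hJs hJ
    obtain ⟨P, hJP, hP⟩ := zorn_le_nonempty₀
      {P : Ideal A | P.IsRadical ∧ IsStable δ P ∧ NotFinitelyGenerated δ P} (by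
        intro c hc hchain y hy
        have hne : c.Nonempty := ⟨y, hy⟩
        refine ⟨sSup c, ⟨isRadical_sSup hne hchain.directedOn fun _ hJ => (hc hJ).1,
          IsStable.sSup hne hchain.directedOn fun _ hJ => (hc hJ).2.1, fun F hF hle => ?_⟩,
          fun _ => le_sSup⟩
        obtain ⟨K, hK, hFK⟩ := exists_finset_subset_of_subset_sSup hne hchain.directedOn F hF
        exact (hc hK).2.2 F hFK ((le_sSup hK).trans hle)) J ⟨hJr, hJs, hJ⟩
    have hadd := fun (s : A) (hs : s ∉ P) => exists_finset_of_le_radicalClosure_insert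
      (fun J hJr hJs hJ hle => hP.2 ⟨hJr, hJs, hJ⟩ hle) hs
    obtain ⟨⟨hPr, hPs, hPn⟩, -⟩ := hP
    refine h P ⟨fun htop => hPn {1} ?_ ?_, fun {a b} hab => ?_⟩ hPs hPn hadd
    · simp [htop]
    · rw [htop, top_le_iff, Ideal.eq_top_iff_one]
      exact subset_radicalClosure (by simp)
    · by_contra! hcon
      obtain ⟨F, hF, hPF⟩ := hadd a hcon.1
      obtain ⟨G, hG, hPG⟩ := hadd b hcon.2
      refine hPn (insert (a * b) (F ∪ G)) ?_ fun x hx => ?_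
      · simpa [Set.insert_subset_iff, hF, hG] using hab
      · refine isRadical_radicalClosure ⟨2, ?_⟩
        rw [pow_two]
        refine mul_mem_of_mem_radicalClosure isRadical_radicalClosure isStable_radicalClosure
          ?_ (hPF hx) (hPG hx)
        have hmem : ∀ z ∈ insert (a * b) (F ∪ G),
            z ∈ radicalClosure δ (insert (a * b) (F ∪ G) : Finset A) := fun z hz =>
          subset_radicalClosure hz
        rintro x (rfl | hx) y (rfl | hy)
        · exact hmem _ (by simp)
        · exact Ideal.mul_mem_left _ _ (hmem _ (by simp [Finset.mem_coe.1 hy]))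
        · exact Ideal.mul_mem_right _ _ (hmem _ (by simp [Finset.mem_coe.1 hx]))
        · exact Ideal.mul_mem_right _ _ (hmem _ (by simp [Finset.mem_coe.1 hx]))
  have hne : (Set.range I).Nonempty := Set.range_nonempty I
  have hdir : DirectedOn (· ≤ ·) (Set.range I) := hI.directed_le.directedOn_range
  have hU := hfg (sSup (Set.range I)) (isRadical_sSup hne hdir (by simpa using hIr))
    (IsStable.sSup hne hdir (by simpa using hIs))
  simp only [NotFinitelyGenerated, not_forall, not_not] at hU
  obtain ⟨F, hF, hle⟩ := hU
  obtain ⟨_, ⟨n, rfl⟩, hFn⟩ := exists_finset_subset_of_subset_sSup hne hdir F hF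
  exact ⟨n, fun m hm => le_antisymm ((le_sSup (Set.mem_range_self m)).trans
    (hle.trans (radicalClosure_le (hIr n) (hIs n) hFn))) (hI hm)⟩

end StableIdeal

/-! ### Separants and pseudo-division -/

namespace MvPolynomial

variable {ι k : Type*}

theorem card_degrees_lt [CommSemiring k] {f g : MvPolynomial ι k}
    (h : ∀ x, g.degreeOf x ≤ f.degreeOf x) {N : ι} (hN : g.degreeOf N < f.degreeOf N) :
    g.degrees.card < f.degrees.card := by
  classical
  simp only [degreeOf_def] at h hN
  refine Multiset.card_lt_card (lt_of_le_of_ne (Multiset.le_iff_count.2 h) fun he => ?_)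
  rw [he] at hN
  exact hN.false

section pderiv

variable [CommSemiring k]

theorem add_single_mem_support_of_mem_support_pderiv {f : MvPolynomial ι k} {N : ι} {m : ι →₀ ℕ}
    (hm : m ∈ (pderiv N f).support) : m + Finsupp.single N 1 ∈ f.support := by
  rw [mem_support_iff, coeff_pderiv] at hm
  rw [mem_support_iff]
  exact left_ne_zero_of_mul hm

theorem degreeOf_pderiv_le (f : MvPolynomial ι k) (N x : ι) :
    (pderiv N f).degreeOf x ≤ f.degreeOf x := by
  refine degreeOf_le_iff.2 fun m hm => ?_
  refine le_trans ?_ (monomial_le_degreeOf x (add_single_mem_support_of_mem_support_pderiv hm))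
  simp

theorem degreeOf_pderiv_self_lt {f : MvPolynomial ι k} {N : ι} (hN : N ∈ f.vars) :
    (pderiv N f).degreeOf N < f.degreeOf N := by
  refine (degreeOf_lt_iff (Nat.pos_of_ne_zero (mem_vars_iff_degreeOf_ne_zero.1 hN))).2
    fun m hm => ?_
  have := monomial_le_degreeOf N (add_single_mem_support_of_mem_support_pderiv hm)
  simp at this
  omega

theorem vars_subset_of_degreeOf_le {f g : MvPolynomial ι k}
    (h : ∀ x, g.degreeOf x ≤ f.degreeOf x) : g.vars ⊆ f.vars := fun x hx => by
  rw [mem_vars_iff_degreeOf_ne_zero] at hx ⊢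
  have := h x
  omega

theorem vars_pderiv_subset {f : MvPolynomial ι k} {V : Set ι} (N : ι)
    (hf : (f.vars : Set ι) ⊆ V) : ((pderiv N f).vars : Set ι) ⊆ V :=
  (Finset.coe_subset.2 (vars_subset_of_degreeOf_le (degreeOf_pderiv_le f N))).trans hf

theorem coeff_X_mul_pderiv (f : MvPolynomial ι k) (N : ι) (m : ι →₀ ℕ) :
    (X N * pderiv N f).coeff m = m N * f.coeff m := by
  classical
  rw [coeff_X_mul']
  split_ifs with h
  · rw [coeff_pderiv]
    have h1 : Finsupp.single N 1 ≤ m := by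
      rw [Finsupp.single_le_iff]
      exact Nat.one_le_iff_ne_zero.2 (Finsupp.mem_support_iff.1 h)
    rw [tsub_add_cancel_of_le h1, mul_comm]
    congr 1
    have h2 : 1 ≤ m N := Finsupp.single_le_iff.1 h1
    have h3 : (m - Finsupp.single N 1 : ι →₀ ℕ) N + 1 = m N := by
      simp [Nat.sub_add_cancel h2]
    exact_mod_cast congrArg (Nat.cast (R := k)) h3
  · rw [Finsupp.notMem_support_iff.1 h]
    simp

end pderiv

section Field

variable [Field k] [CharZero k]

/-- Subtracting `X_N ∂f/∂X_N` divided by the degree `d` of `f` in `X_N` removes the monomials of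
degree `d` in `X_N`. -/
theorem exists_sub_mul_pderiv {f : MvPolynomial ι k} {N : ι} (hN : N ∈ f.vars) :
    ∃ q : MvPolynomial ι k, (∀ x, (f - q * pderiv N f).degreeOf x ≤ f.degreeOf x) ∧
      (f - q * pderiv N f).degreeOf N < f.degreeOf N := by
  set d := f.degreeOf N with hd
  have hd0 : d ≠ 0 := mem_vars_iff_degreeOf_ne_zero.1 hN
  refine ⟨C (d : k)⁻¹ * X N, ?_⟩
  have hcoeff : ∀ m, (f - C (d : k)⁻¹ * X N * pderiv N f).coeff m =
      (1 - (d : k)⁻¹ * m N) * f.coeff m := fun m => by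
    rw [coeff_sub, mul_assoc, coeff_C_mul, coeff_X_mul_pderiv]
    ring
  have hsupp : ∀ m ∈ (f - C (d : k)⁻¹ * X N * pderiv N f).support, m ∈ f.support ∧ m N ≠ d := by
    intro m hm
    rw [mem_support_iff, hcoeff] at hm
    refine ⟨mem_support_iff.2 (right_ne_zero_of_mul hm), fun h => left_ne_zero_of_mul hm ?_⟩
    rw [h, inv_mul_cancel₀ (by exact_mod_cast hd0), sub_self]
  refine ⟨fun x => degreeOf_le_iff.2 fun m hm => monomial_le_degreeOf x (hsupp m hm).1,
    (degreeOf_lt_iff (Nat.pos_of_ne_zero hd0)).2 fun m hm => ?_⟩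
  exact lt_of_le_of_ne (monomial_le_degreeOf N (hsupp m hm).1) (hsupp m hm).2

end Field

/-- Pseudo-division by a polynomial `a * X K + t` linear in the variable `K`. -/
theorem exists_pseudo_remainder [CommRing k] {W : Set ι} {K : ι} {a t f : MvPolynomial ι k}
    (ha : a ∈ supported k W) (ht : t ∈ supported k W) (hf : f ∈ supported k (insert K W)) :
    ∃ d : ℕ, ∃ g ∈ supported k W, g - a ^ d * f ∈ Ideal.span {a * X K + t} := by
  unfold supported at hf
  induction hf using Algebra.adjoin_induction with
  | mem x hx =>
    obtain ⟨y, rfl | hy, rfl⟩ := hx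
    · refine ⟨1, -t, neg_mem ht, ?_⟩
      have : -t - a ^ 1 * X y = -(a * X y + t) := by ring
      rw [this]
      exact neg_mem (Ideal.mem_span_singleton_self _)
    · exact ⟨0, X y, Algebra.subset_adjoin ⟨y, hy, rfl⟩, by simp⟩
  | algebraMap r => exact ⟨0, _, Subalgebra.algebraMap_mem _ r, by simp⟩
  | add f₁ f₂ _ _ h₁ h₂ =>
    obtain ⟨d₁, g₁, hg₁, h₁⟩ := h₁
    obtain ⟨d₂, g₂, hg₂, h₂⟩ := h₂
    refine ⟨d₁ + d₂, a ^ d₂ * g₁ + a ^ d₁ * g₂,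
      add_mem (mul_mem (pow_mem ha _) hg₁) (mul_mem (pow_mem ha _) hg₂), ?_⟩
    have : a ^ d₂ * g₁ + a ^ d₁ * g₂ - a ^ (d₁ + d₂) * (f₁ + f₂) =
        a ^ d₂ * (g₁ - a ^ d₁ * f₁) + a ^ d₁ * (g₂ - a ^ d₂ * f₂) := by ring
    rw [this]
    exact add_mem (Ideal.mul_mem_left _ _ h₁) (Ideal.mul_mem_left _ _ h₂)
  | mul f₁ f₂ _ _ h₁ h₂ =>
    obtain ⟨d₁, g₁, hg₁, h₁⟩ := h₁
    obtain ⟨d₂, g₂, hg₂, h₂⟩ := h₂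
    refine ⟨d₁ + d₂, g₁ * g₂, mul_mem hg₁ hg₂, ?_⟩
    have : g₁ * g₂ - a ^ (d₁ + d₂) * (f₁ * f₂) =
        g₂ * (g₁ - a ^ d₁ * f₁) + a ^ d₁ * f₁ * (g₂ - a ^ d₂ * f₂) := by ring
    rw [this]
    exact add_mem (Ideal.mul_mem_left _ _ h₁) (Ideal.mul_mem_left _ _ h₂)

/-- By Hilbert's basis theorem, the elements of an ideal that only involve a given finite set of
variables lie in the ideal generated by finitely many elements of that ideal. -/
theorem exists_finset_supported_subset_span [Field k] (P : Ideal (MvPolynomial ι k))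
    (V : Finset ι) : ∃ F : Finset (MvPolynomial ι k), (F : Set (MvPolynomial ι k)) ⊆ P ∧
      ∀ f ∈ P, (f.vars : Set ι) ⊆ V → f ∈ Ideal.span (F : Set (MvPolynomial ι k)) := by
  classical
  let φ : MvPolynomial V k →ₐ[k] MvPolynomial ι k := rename (↑)
  obtain ⟨G, hG⟩ := (isNoetherianRing_iff_ideal_fg (MvPolynomial V k)).1 inferInstance
    (P.comap φ)
  refine ⟨G.image φ, ?_, fun f hf hV => ?_⟩
  · intro x hx
    obtain ⟨g, hg, rfl⟩ := Finset.mem_image.1 (Finset.mem_coe.1 hx)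
    have : g ∈ P.comap φ := hG ▸ Ideal.subset_span hg
    exact this
  · obtain ⟨g, rfl⟩ : ∃ g, φ g = f :=
      exists_rename_eq_of_vars_subset_range f _ Subtype.val_injective (by simpa using hV)
    have hg : g ∈ Ideal.span (G : Set (MvPolynomial V k)) := by
      rw [hG]
      exact hf
    have := Ideal.mem_map_of_mem φ hg
    rw [Ideal.map_span] at this
    simpa using this

end MvPolynomial

/-! ### Ranking the variables from the inside out -/

/-- A ranking of a linear order by natural numbers whose maximum over an interval is attained at an
endpoint. -/
structure IsConvexRanking {ι : Type*} [LinearOrder ι] (ρ : ι → ℕ) : Prop where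
  injective : Function.Injective ρ
  le_max : ∀ x y z, x ≤ y → y ≤ z → ρ y ≤ max (ρ x) (ρ z)

theorem exists_isConvexRanking (ι : Type*) [LinearOrder ι] [LocallyFiniteOrder ι] :
    ∃ ρ : ι → ℕ, IsConvexRanking ρ := by
  classical
  cases isEmpty_or_nonempty ι with
  | inl h => exact ⟨fun _ => 0, ⟨fun x => h.elim x, fun x => h.elim x⟩⟩
  | inr h =>
    obtain ⟨z⟩ := h
    have hr : ∀ x y, z ≤ x → x < y → (Finset.Icc z x).card < (Finset.Icc z y).card :=
      fun x y hx hxy => Finset.card_lt_card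
        ((Finset.Icc_ssubset_Icc_right (hx.trans hxy.le) le_rfl hxy))
    have hl : ∀ x y, y ≤ z → x < y → (Finset.Icc y z).card < (Finset.Icc x z).card :=
      fun x y hy hxy => Finset.card_lt_card
        ((Finset.Icc_ssubset_Icc_left (hxy.le.trans hy) hxy le_rfl))
    refine ⟨fun x => if z ≤ x then 2 * (Finset.Icc z x).card else 2 * (Finset.Icc x z).card + 1,
      ⟨fun x y hxy => ?_, fun x y w hxy hyw => ?_⟩⟩
    · by_contra hne
      wlog hlt : x < y generalizing x y
      · exact this y x hxy.symm (Ne.symm hne) (lt_of_le_of_ne (not_lt.1 hlt) (Ne.symm hne))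
      split_ifs at hxy with h1 h2 h2
      · have := hr x y h1 hlt; omega
      · exact h2 (h1.trans hlt.le)
      · omega
      · have := hl x y (not_le.1 h2).le hlt; omega
    · by_cases hy : z ≤ y
      · refine le_trans ?_ (le_max_right _ _)
        rw [if_pos hy, if_pos (hy.trans hyw)]
        have := Finset.card_le_card (Finset.Icc_subset_Icc (le_refl z) hyw)
        omega
      · refine le_trans ?_ (le_max_left _ _)
        rw [if_neg hy, if_neg fun h => hy (h.trans hxy)]
        have := Finset.card_le_card (Finset.Icc_subset_Icc hxy (le_refl z))
        omega

namespace IsConvexRanking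

variable {ι : Type*} [LinearOrder ι] {ρ : ι → ℕ}

theorem orderDual (hρ : IsConvexRanking ρ) : IsConvexRanking (ι := ιᵒᵈ) ρ where
  injective := hρ.injective
  le_max x y z hxy hyz := max_comm (ρ z) (ρ x) ▸ hρ.le_max z y x hyz hxy

/-- Let `V` be a set of elements smaller than `N`, and suppose that elements of `V` below `M` are at
least some `M'` which does not have larger rank than `M` and `N`. If `V` is not contained in the
interval from `M` to `N`, then its elements have smaller rank than `N`. -/
theorem subset_Ico_or_lt (hρ : IsConvexRanking ρ) {M M' N : ι} (hMN : M ≤ N)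
    (hM' : ρ M' ≤ max (ρ M) (ρ N)) {V : Set ι} (hV : V ⊆ Set.Ico (min M' M) N) :
    V ⊆ Set.Ico M N ∨ V.Nonempty ∧ ∀ y ∈ V, ρ y < max (ρ M) (ρ N) := by
  by_cases hsub : V ⊆ Set.Ico M N
  · exact Or.inl hsub
  refine Or.inr ?_
  obtain ⟨x, hxV, hx⟩ := Set.not_subset.1 hsub
  have hxN : x < N := (hV hxV).2
  have hxM : x < M := not_le.1 fun h => hx ⟨h, hxN⟩
  have hM'x : M' ≤ x := (min_le_iff.1 (hV hxV).1).resolve_right (not_le.2 hxM)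
  -- Here `ρ N` is the maximum: otherwise the ranks of `x` and `M` would coincide.
  have hmax : ρ M ≤ ρ N := by
    by_contra! hlt
    have h1 := hρ.le_max M' x M hM'x hxM.le
    have h2 := hρ.le_max x M N hxM.le hMN
    exact hxM.ne (hρ.injective (by grind))
  rw [max_eq_right hmax] at hM' ⊢
  refine ⟨⟨x, hxV⟩, fun y hy => lt_of_le_of_ne ?_ fun h => (hV hy).2.ne (hρ.injective h)⟩
  have h3 : M' ≤ y := by
    have := (hV hy).1
    rwa [min_eq_left (hM'x.trans hxM.le)] at this
  have := hρ.le_max M' y N h3 (hV hy).2.le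
  rwa [max_eq_right hM'] at this

theorem subset_Ioc_or_lt (hρ : IsConvexRanking ρ) {M N N' : ι} (hMN : M ≤ N)
    (hN' : ρ N' ≤ max (ρ M) (ρ N)) {V : Set ι} (hV : V ⊆ Set.Ioc M (max N' N)) :
    V ⊆ Set.Ioc M N ∨ V.Nonempty ∧ ∀ y ∈ V, ρ y < max (ρ M) (ρ N) := by
  have := hρ.orderDual.subset_Ico_or_lt (M := OrderDual.toDual N) (M' := OrderDual.toDual N')
    (N := OrderDual.toDual M) (V := V) hMN (max_comm (ρ M) (ρ N) ▸ hN')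
    (fun x hx => ⟨(hV hx).2, (hV hx).1⟩)
  refine this.imp (fun h x hx => ⟨(h hx).2, (h hx).1⟩) fun h => ⟨h.1, fun y hy => ?_⟩
  rw [max_comm]
  exact h.2 y hy

end IsConvexRanking

/-! ### The complexity of a polynomial -/

namespace MvPolynomial

variable {ι k : Type*} [LinearOrder ι] [CommSemiring k]

/-- The largest rank of a variable of `f`. -/
def maxRank (ρ : ι → ℕ) (f : MvPolynomial ι k) : ℕ := f.vars.sup ρ

theorem maxRank_eq {ρ : ι → ℕ} {f : MvPolynomial ι k} {M N : ι}
    (hρ : IsConvexRanking ρ) (hM : M ∈ f.vars) (hN : N ∈ f.vars)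
    (hf : (f.vars : Set ι) ⊆ Set.Icc M N) : maxRank ρ f = max (ρ M) (ρ N) :=
  le_antisymm (Finset.sup_le fun x hx => hρ.le_max M x N (hf hx).1 (hf hx).2)
    (max_le (Finset.le_sup hM) (Finset.le_sup hN))

variable [LocallyFiniteOrder ι]

/-- The number of elements of the interval spanned by the variables of `f`. -/
def width (f : MvPolynomial ι k) : ℕ :=
  (f.vars ×ˢ f.vars).sup fun p => (Finset.Icc p.1 p.2).card

/-- Polynomials are compared by the largest rank of their variables, then by the length of the
interval spanned by their variables, then by their number of variables counted with
multiplicity. -/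
def complexity (ρ : ι → ℕ) (f : MvPolynomial ι k) : ℕ ×ₗ ℕ ×ₗ ℕ :=
  toLex (maxRank ρ f, toLex (width f, f.degrees.card))

variable {ρ : ι → ℕ} {f g : MvPolynomial ι k} {M N : ι}

theorem maxRank_le_of_complexity_le (h : complexity ρ f ≤ complexity ρ g) :
    maxRank ρ f ≤ maxRank ρ g := by
  rcases Prod.Lex.toLex_le_toLex.1 h with h | h
  · exact h.le
  · exact h.1.le

theorem complexity_lt_of_degreeOf (h : ∀ x, g.degreeOf x ≤ f.degreeOf x)
    (hN : g.degreeOf N < f.degreeOf N) : complexity ρ g < complexity ρ f := by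
  have hv := vars_subset_of_degreeOf_le h
  have h1 : maxRank ρ g ≤ maxRank ρ f := Finset.sup_mono hv
  have h2 : width g ≤ width f := Finset.sup_mono (Finset.product_subset_product hv hv)
  have h3 := card_degrees_lt h hN
  simp only [complexity, Prod.Lex.toLex_lt_toLex]
  omega

theorem complexity_lt_of_vars (hρ : IsConvexRanking ρ) (hM : M ∈ f.vars) (hN : N ∈ f.vars)
    (hMN : M ≤ N) (hf : (f.vars : Set ι) ⊆ Set.Icc M N)
    (h : (g.vars : Set ι) ⊆ Set.Ico M N ∨ (g.vars : Set ι) ⊆ Set.Ioc M N ∨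
      (g.vars : Set ι).Nonempty ∧ ∀ y ∈ (g.vars : Set ι), ρ y < max (ρ M) (ρ N)) :
    complexity ρ g < complexity ρ f := by
  have hr := maxRank_eq hρ hM hN hf
  have hw : (Finset.Icc M N).card ≤ width f :=
    Finset.le_sup (f := fun p : ι × ι => (Finset.Icc p.1 p.2).card) (b := (M, N)) (by simp [*])
  have hpos : 0 < (Finset.Icc M N).card := Finset.card_pos.2 ⟨M, by simp [hMN]⟩
  -- An interval which is properly contained in that of `f` makes the width drop.
  have key : (g.vars : Set ι) ⊆ Set.Icc M N →
      (∀ x ∈ g.vars, ∀ y ∈ g.vars, Finset.Icc x y ⊂ Finset.Icc M N) →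
      complexity ρ g < complexity ρ f := by
    intro h0 h1
    have hr' : maxRank ρ g ≤ maxRank ρ f :=
      hr ▸ Finset.sup_le fun x hx => hρ.le_max M x N (h0 hx).1 (h0 hx).2
    have hw' : width g < width f := by
      refine lt_of_lt_of_le ((Finset.sup_lt_iff hpos).2 fun p hp => ?_) hw
      rw [Finset.mem_product] at hp
      exact Finset.card_lt_card (h1 _ hp.1 _ hp.2)
    simp only [complexity, Prod.Lex.toLex_lt_toLex]
    omega
  rcases h with h | h | ⟨⟨x, hx⟩, h⟩
  · exact key (h.trans Set.Ico_subset_Icc_self) fun x hx y hy =>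
      Finset.Icc_ssubset_Icc_right hMN (h hx).1 (h hy).2
  · exact key (h.trans Set.Ioc_subset_Icc_self) fun x hx y hy =>
      Finset.Icc_ssubset_Icc_left hMN (h hx).1 (h hy).2
  · have : maxRank ρ g < maxRank ρ f :=
      hr ▸ (Finset.sup_lt_iff (lt_of_le_of_lt (Nat.zero_le _) (h x hx))).2 h
    simp only [complexity, Prod.Lex.toLex_lt_toLex]
    omega

end MvPolynomial

/-! ### The chain condition for a polynomial ring with derivations -/

namespace StableIdeal

variable {k ι σ : Type*} [Field k]

theorem exists_pow_mul_mem [LinearOrder ι] [LocallyFiniteOrder ι] {ρ : ι → ℕ}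
    {P I : Ideal (MvPolynomial ι k)} (hIP : I ≤ P) {f : MvPolynomial ι k} (hf : f ∈ P)
    (hmin : ∀ g ∈ P, complexity ρ g < complexity ρ f → g ∈ I) {u s : MvPolynomial ι k}
    (hu : u ∈ I) {W : Set ι} {K : ι} {c : k} (hc : c ≠ 0) (hs : s ∈ supported k W)
    (hus : u - C c * s * X K ∈ supported k W) (hfW : f ∈ supported k (insert K W))
    (hW : ∀ g ∈ supported k W, complexity ρ g < complexity ρ f) : ∃ d : ℕ, s ^ d * f ∈ I := by
  obtain ⟨d, g, hg, hgf⟩ := exists_pseudo_remainder (K := K) (a := C c * s)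
    (mul_mem (Subalgebra.algebraMap_mem _ c) hs) hus hfW
  rw [show C c * s * X K + (u - C c * s * X K) = u by ring] at hgf
  have hgf : g - (C c * s) ^ d * f ∈ I := (Ideal.span_singleton_le_iff_mem I).2 hu hgf
  have hgP : g ∈ P := by
    have := P.add_mem (hIP hgf) (P.mul_mem_left ((C c * s) ^ d) hf)
    rwa [sub_add_cancel] at this
  have hgI := I.mul_mem_left (C c⁻¹ ^ d) (I.sub_mem (hmin g hgP (hW g hg)) hgf)
  refine ⟨d, ?_⟩
  have h1 : C c⁻¹ * C c = (1 : MvPolynomial ι k) := by rw [← C_mul, inv_mul_cancel₀ hc, C_1]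
  have h2 : C c⁻¹ ^ d * (g - (g - (C c * s) ^ d * f)) = (C c⁻¹ * C c) ^ d * (s ^ d * f) := by ring
  rwa [h2, h1, one_pow, one_mul] at hgI

variable [LinearOrder ι]

/-- Some operation `Φ` preserving all stable ideals sends each polynomial `f` in variables up to `N`
to a polynomial in variables up to `K`, where `K > N`, in which `K` occurs linearly with coefficient
a nonzero constant times the separant `∂f/∂N`; moreover `Φ` does not introduce variables below those
of `f`. -/
def UpperProlongation (δ : σ → Derivation k (MvPolynomial ι k) (MvPolynomial ι k)) (N K : ι) :
    Prop :=
  ∃ Φ : MvPolynomial ι k → MvPolynomial ι k,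
    (∀ I : Ideal (MvPolynomial ι k), IsStable δ I → ∀ f ∈ I, Φ f ∈ I) ∧
    ∃ c : k, c ≠ 0 ∧ N < K ∧ ∀ M ≤ N, ∀ f ∈ supported k (Set.Icc M N),
      Φ f - C c * pderiv N f * X K ∈ supported k (Set.Ico M K)

/-- The mirror image of `UpperProlongation`, for smallest variables. -/
def LowerProlongation (δ : σ → Derivation k (MvPolynomial ι k) (MvPolynomial ι k)) (M K : ι) :
    Prop :=
  ∃ Φ : MvPolynomial ι k → MvPolynomial ι k,
    (∀ I : Ideal (MvPolynomial ι k), IsStable δ I → ∀ f ∈ I, Φ f ∈ I) ∧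
    ∃ c : k, c ≠ 0 ∧ K < M ∧ ∀ N ≥ M, ∀ f ∈ supported k (Set.Icc M N),
      Φ f - C c * pderiv M f * X K ∈ supported k (Set.Ioc K N)

variable [LocallyFiniteOrder ι] {δ : σ → Derivation k (MvPolynomial ι k) (MvPolynomial ι k)}

/-- If `f` has minimal complexity among the elements of `P` outside an ideal `I`, then its
separants do not lie in `P`: otherwise the separant, and `f` minus a multiple of the separant, would
be simpler than `f`, hence lie in `I`. -/
theorem pderiv_notMem [CharZero k] {P I : Ideal (MvPolynomial ι k)} {ρ : ι → ℕ}
    {f : MvPolynomial ι k} (hf : f ∈ P) (hfI : f ∉ I)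
    (hmin : ∀ g ∈ P, complexity ρ g < complexity ρ f → g ∈ I) {N : ι} (hN : N ∈ f.vars) :
    pderiv N f ∉ P := by
  intro hs
  obtain ⟨q, hq, hqN⟩ := exists_sub_mul_pderiv hN
  refine hfI ?_
  rw [← sub_add_cancel f (q * pderiv N f)]
  refine I.add_mem (hmin _ (P.sub_mem hf (P.mul_mem_left q hs)) (complexity_lt_of_degreeOf hq hqN))
    (I.mul_mem_left q (hmin _ hs ?_))
  exact complexity_lt_of_degreeOf (degreeOf_pderiv_le f N) (degreeOf_pderiv_self_lt hN)

/-- Polynomials of minimal complexity in a prime ideal which is not finitely generated as a radical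
stable ideal, together with a finite part of the ideal accounting for them. -/
theorem exists_minimal_polynomial [CharZero k] (ρ : ι → ℕ) {P : Ideal (MvPolynomial ι k)}
    (hP : P.IsPrime) (hPn : NotFinitelyGenerated δ P)
    (hadd : ∀ s ∉ P, ∃ F : Finset (MvPolynomial ι k), (F : Set (MvPolynomial ι k)) ⊆ P ∧
      P ≤ radicalClosure δ (insert s (F : Set (MvPolynomial ι k))))
    (F : {F : Finset (MvPolynomial ι k) // (F : Set (MvPolynomial ι k)) ⊆ P}) :
    ∃ f ∈ P, ∃ M ∈ f.vars, ∃ N ∈ f.vars,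
      ∃ F' : {F : Finset (MvPolynomial ι k) // (F : Set (MvPolynomial ι k)) ⊆ P},
      f ∉ radicalClosure δ (F.1 : Set (MvPolynomial ι k)) ∧
      (∀ g ∈ P, complexity ρ g < complexity ρ f →
        g ∈ radicalClosure δ (F.1 : Set (MvPolynomial ι k))) ∧
      (f.vars : Set ι) ⊆ Set.Icc M N ∧ F.1 ⊆ F'.1 ∧
      (∀ g ∈ P, (g.vars : Set ι) ⊆ Set.Icc M N →
        g ∈ radicalClosure δ (F'.1 : Set (MvPolynomial ι k))) ∧
      P ≤ radicalClosure δ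
        (insert (pderiv M f * pderiv N f) (F'.1 : Set (MvPolynomial ι k))) := by
  classical
  obtain ⟨f₀, hf₀⟩ := SetLike.not_le_iff_exists.1 (hPn F.1 F.2)
  obtain ⟨f, ⟨hfP, hfF⟩, hmin⟩ := (InvImage.wf (complexity ρ) wellFounded_lt).has_min
    {f | f ∈ P ∧ f ∉ radicalClosure δ (F.1 : Set (MvPolynomial ι k))} ⟨f₀, hf₀⟩
  replace hmin : ∀ g ∈ P, complexity ρ g < complexity ρ f →
      g ∈ radicalClosure δ (F.1 : Set (MvPolynomial ι k)) := fun g hg hlt => by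
    by_contra hcon
    exact hmin g ⟨hg, hcon⟩ hlt
  have hvars : f.vars.Nonempty := by
    rw [Finset.nonempty_iff_ne_empty]
    intro h
    rw [vars_eq_empty_iff_eq_C] at h
    rcases eq_or_ne (f.coeff 0) 0 with h0 | h0
    · rw [h0, C_0] at h
      exact hfF (h ▸ zero_mem _)
    · refine hP.ne_top (P.eq_top_of_isUnit_mem hfP ?_)
      rw [h]
      exact (isUnit_iff_ne_zero.2 h0).map C
  have hM := Finset.min'_mem _ hvars
  have hN := Finset.max'_mem _ hvars
  obtain ⟨G, hG, hGs⟩ := hadd _ (hP.mul_notMem (pderiv_notMem hfP hfF hmin hM)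
    (pderiv_notMem hfP hfF hmin hN))
  obtain ⟨H, hH, hHs⟩ := exists_finset_supported_subset_span P
    (Finset.Icc (f.vars.min' hvars) (f.vars.max' hvars))
  refine ⟨f, hfP, _, hM, _, hN, ⟨F.1 ∪ (G ∪ H), ?_⟩, hfF, hmin,
    fun x hx => ⟨Finset.min'_le _ _ hx, Finset.le_max' _ _ hx⟩, Finset.subset_union_left,
    fun g hg hgv => ?_, hGs.trans (radicalClosure_mono (Set.insert_subset_insert ?_))⟩
  · simp [F.2, hG, hH]
  · refine (Ideal.span_le.2 ?_) (hHs g hg (by simpa using hgv))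
    exact (Finset.coe_subset.2 (Finset.subset_union_right.trans
      Finset.subset_union_right)).trans subset_radicalClosure
  · exact Finset.coe_subset.2 (Finset.subset_union_left.trans Finset.subset_union_right)

/-- The chain condition for radical stable ideals of a polynomial ring, under the assumption that
there is no infinite sequence of distinct intervals for which no upper end is an upper prolongation
of an earlier one and no lower end is a lower prolongation of an earlier one. -/
theorem ascending_chain_condition_of_prolongations [CharZero k]
    (hseq : ∀ p : ℕ → ι × ι, Function.Injective p → (∀ i, (p i).1 ≤ (p i).2) →
      ∃ i j, i < j ∧ (LowerProlongation δ (p i).1 (p j).1 ∨ UpperProlongation δ (p i).2 (p j).2))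
    (I : ℕ → Ideal (MvPolynomial ι k)) (hI : Monotone I) (hIr : ∀ n, (I n).IsRadical)
    (hIs : ∀ n, IsStable δ (I n)) : ∃ n, ∀ m, n ≤ m → I m = I n := by
  refine ascending_chain_condition (fun P hP hPs hPn hadd => ?_) I hI hIr hIs
  obtain ⟨ρ, hρ⟩ := exists_isConvexRanking ι
  choose f hfP M hM N hN next hfF hmin hvars hnext hint hsep using
    exists_minimal_polynomial ρ hP hPn hadd
  let F : ℕ → {F : Finset (MvPolynomial ι k) // (F : Set (MvPolynomial ι k)) ⊆ P} :=
    fun n => Nat.rec ⟨∅, by simp⟩ (fun _ F => next F) n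
  have hF : Monotone fun n => (F n).1 := monotone_nat_of_le_succ fun n => hnext (F n)
  let J : ℕ → Ideal (MvPolynomial ι k) :=
    fun n => radicalClosure δ ((F n).1 : Set (MvPolynomial ι k))
  have hJ : Monotone J := fun i j hij => radicalClosure_mono (Finset.coe_subset.2 (hF hij))
  have hJP : ∀ n, J n ≤ P := fun n => radicalClosure_le hP.isRadical hPs (F n).2
  have hJr : ∀ n, (J n).IsRadical := fun n => isRadical_radicalClosure
  have hJs : ∀ n, IsStable δ (J n) := fun n => isStable_radicalClosure
  have hMN : ∀ n, M (F n) ≤ N (F n) := fun n => (hvars (F n) (hM (F n))).2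
  have hinj : Function.Injective fun n => (M (F n), N (F n)) := by
    intro i j hij
    by_contra hne
    wlog hlt : i < j generalizing i j
    · exact this hij.symm (Ne.symm hne) (lt_of_le_of_ne (not_lt.1 hlt) (Ne.symm hne))
    rw [Prod.mk.injEq] at hij
    refine hfF (F j) (hJ (Nat.succ_le_of_lt hlt) (hint (F i) _ (hfP (F j)) ?_))
    rw [hij.1, hij.2]
    exact hvars (F j)
  obtain ⟨i, j, hij, hpro⟩ := hseq _ hinj hMN
  have hrank : max (ρ (M (F i))) (ρ (N (F i))) ≤ max (ρ (M (F j))) (ρ (N (F j))) := by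
    rw [← maxRank_eq hρ (hM _) (hN _) (hvars _), ← maxRank_eq hρ (hM _) (hN _) (hvars _)]
    exact maxRank_le_of_complexity_le (not_lt.1 fun hlt => hfF (F j) (hJ hij.le
      (hmin (F i) _ (hfP (F j)) hlt)))
  have hfi : f (F i) ∈ J j :=
    hJ (Nat.succ_le_of_lt hij) (hint (F i) _ (hfP (F i)) (hvars (F i)))
  -- Elimination shows that the separants of the earlier polynomial carry the later one into the
  -- ideal generated so far.
  have hred : ∃ d : ℕ, pderiv (M (F i)) (f (F i)) ^ d * f (F j) ∈ J j ∨
      pderiv (N (F i)) (f (F i)) ^ d * f (F j) ∈ J j := by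
    have hMi := max_le_iff.1 hrank
    rcases hpro with ⟨Φ, hΦ, c, hc, hlt, hΦc⟩ | ⟨Φ, hΦ, c, hc, hlt, hΦc⟩
    · dsimp only at hlt hΦc
      obtain ⟨d, hd⟩ := exists_pow_mul_mem (hJP j) (hfP (F j))
        (fun g hg hlt => hmin (F j) g hg hlt) (hΦ _ (hJs j) _ hfi)
        (W := Set.Ioc (M (F j)) (max (N (F i)) (N (F j)))) hc
        (s := pderiv (M (F i)) (f (F i)))
        (mem_supported.2 (vars_pderiv_subset _ ((hvars (F i)).trans
          fun x hx => ⟨lt_of_lt_of_le hlt hx.1, le_max_of_le_left hx.2⟩)))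
        (supported_mono (Set.Ioc_subset_Ioc_right (le_max_left _ _))
          (hΦc _ (hMN _) _ (mem_supported.2 (hvars (F i)))))
        (mem_supported.2 ((hvars (F j)).trans fun x hx => hx.1.eq_or_lt.imp Eq.symm
          fun h => ⟨h, le_max_of_le_right hx.2⟩))
        fun g hg => complexity_lt_of_vars hρ (hM _) (hN _) (hMN j) (hvars _)
          (Or.inr (hρ.subset_Ioc_or_lt (hMN j) hMi.2 (mem_supported.1 hg)))
      exact ⟨d, Or.inl hd⟩
    · dsimp only at hlt hΦc
      obtain ⟨d, hd⟩ := exists_pow_mul_mem (hJP j) (hfP (F j))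
        (fun g hg hlt => hmin (F j) g hg hlt) (hΦ _ (hJs j) _ hfi)
        (W := Set.Ico (min (M (F i)) (M (F j))) (N (F j))) hc
        (s := pderiv (N (F i)) (f (F i)))
        (mem_supported.2 (vars_pderiv_subset _ ((hvars (F i)).trans
          fun x hx => ⟨min_le_of_left_le hx.1, lt_of_le_of_lt hx.2 hlt⟩)))
        (supported_mono (Set.Ico_subset_Ico_left (min_le_left _ _))
          (hΦc _ (hMN _) _ (mem_supported.2 (hvars (F i)))))
        (mem_supported.2 ((hvars (F j)).trans fun x hx => hx.2.eq_or_lt.imp id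
          fun h => ⟨min_le_of_right_le hx.1, h⟩))
        fun g hg => complexity_lt_of_vars hρ (hM _) (hN _) (hMN j) (hvars _)
          ((hρ.subset_Ico_or_lt (hMN j) hMi.1 (mem_supported.1 hg)).imp id Or.inr)
      exact ⟨d, Or.inr hd⟩
  set s := pderiv (M (F i)) (f (F i)) * pderiv (N (F i)) (f (F i)) with hs
  have hsf : s * f (F j) ∈ J j := by
    obtain ⟨d, hd⟩ := hred
    refine hJr j ⟨d + 1, ?_⟩
    rcases hd with hd | hd
    · have : (s * f (F j)) ^ (d + 1) = s * pderiv (N (F i)) (f (F i)) ^ d * f (F j) ^ d *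
          (pderiv (M (F i)) (f (F i)) ^ d * f (F j)) := by rw [hs]; ring
      rw [this]
      exact Ideal.mul_mem_left _ _ hd
    · have : (s * f (F j)) ^ (d + 1) = s * pderiv (M (F i)) (f (F i)) ^ d * f (F j) ^ d *
          (pderiv (N (F i)) (f (F i)) ^ d * f (F j)) := by rw [hs]; ring
      rw [this]
      exact Ideal.mul_mem_left _ _ hd
  -- As `P` is generated by `s` and finitely many elements already included, `f * f` lies in the
  -- ideal generated so far.
  refine hfF (F j) (hJr j ⟨2, ?_⟩)
  rw [pow_two]
  refine mul_mem_of_mem_radicalClosure (hJr j) (hJs j) (Y := {f (F j)}) ?_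
    (hsep (F i) (hfP (F j))) (subset_radicalClosure rfl)
  rintro x (rfl | hx) _ rfl
  · exact hsf
  · exact Ideal.mul_mem_right _ _ (subset_radicalClosure (hF (Nat.succ_le_of_lt hij) hx))

end StableIdeal

/-! ### Leading terms of iterated derivatives -/

namespace MvPolynomial

variable {ι k σ : Type*} [Field k]

theorem derivation_mem_supported (D : Derivation k (MvPolynomial ι k) (MvPolynomial ι k))
    {V W : Set ι} (hVW : V ⊆ W) (hD : ∀ x ∈ V, D (X x) ∈ supported k W) {f : MvPolynomial ι k}
    (hf : f ∈ supported k V) : D f ∈ supported k W := by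
  unfold supported at hf
  induction hf using Algebra.adjoin_induction with
  | mem x hx =>
    obtain ⟨y, hy, rfl⟩ := hx
    exact hD y hy
  | algebraMap r => simp
  | add f₁ f₂ _ _ h₁ h₂ => simpa using add_mem h₁ h₂
  | mul f₁ f₂ h₁' h₂' h₁ h₂ =>
    rw [Derivation.leibniz, smul_eq_mul, smul_eq_mul]
    exact add_mem (mul_mem (supported_mono hVW h₁') h₂) (mul_mem (supported_mono hVW h₂') h₁)

theorem derivation_eq_sum_pderiv (D : Derivation k (MvPolynomial ι k) (MvPolynomial ι k))
    (f : MvPolynomial ι k) : D f = ∑ x ∈ f.vars, pderiv x f * D (X x) := by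
  classical
  let E : Derivation k (MvPolynomial ι k) (MvPolynomial ι k) := ∑ x ∈ f.vars, D (X x) • pderiv x
  have hE : ∀ g, E g = ∑ x ∈ f.vars, pderiv x g * D (X x) := fun g => by
    simp only [E, ← Derivation.coeFnAddMonoidHom_apply, map_sum, Finset.sum_apply]
    simp [mul_comm]
  rw [← hE]
  refine derivation_eq_of_forall_mem_vars fun y hy => ?_
  rw [hE]
  simp [pderiv_X, Pi.single_apply, hy]

/-- The iterated derivative of `f` along a list. -/
def iteratedDerivation (δ : σ → Derivation k (MvPolynomial ι k) (MvPolynomial ι k)) (s : List σ)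
    (f : MvPolynomial ι k) : MvPolynomial ι k :=
  s.foldl (fun g i => δ i g) f

variable {δ : σ → Derivation k (MvPolynomial ι k) (MvPolynomial ι k)}

theorem iteratedDerivation_concat (s : List σ) (i : σ) (f : MvPolynomial ι k) :
    iteratedDerivation δ (s ++ [i]) f = δ i (iteratedDerivation δ s f) := by
  simp [iteratedDerivation]

theorem iteratedDerivation_mem {I : Ideal (MvPolynomial ι k)} (hI : StableIdeal.IsStable δ I)
    (s : List σ) {f : MvPolynomial ι k} (hf : f ∈ I) : iteratedDerivation δ s f ∈ I := by
  induction s using List.reverseRecOn with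
  | nil => exact hf
  | append_singleton s i ih => rw [iteratedDerivation_concat]; exact hI i _ ih

theorem iteratedDerivation_mem_supported {V : Set ι} {s : List σ}
    (hV : ∀ i ∈ s, ∀ x ∈ V, δ i (X x) ∈ supported k V) {f : MvPolynomial ι k}
    (hf : f ∈ supported k V) : iteratedDerivation δ s f ∈ supported k V := by
  induction s using List.reverseRecOn with
  | nil => exact hf
  | append_singleton s i ih =>
    rw [iteratedDerivation_concat]
    exact derivation_mem_supported _ subset_rfl (hV i (by simp))
      (ih fun j hj => hV j (by simp [hj]))

section Degree

variable {deg : ι → ℤ} {e : σ → ℤ}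

theorem derivation_mem_supported_degree
    (hδ : ∀ i x, δ i (X x) ∈ supported k {y | deg y = deg x + e i}) {i : σ} (hi : 0 < e i)
    {n m : ℤ} (hm : n + e i ≤ m) {f : MvPolynomial ι k} (hf : f ∈ supported k {y | deg y ≤ n}) :
    δ i f ∈ supported k {y | deg y ≤ m} := by
  refine derivation_mem_supported _ (fun y hy => ?_) (fun x hx => supported_mono ?_ (hδ i x)) hf
  · simp only [Set.mem_ofPred_eq] at hy ⊢
    omega
  · intro y hy
    simp only [Set.mem_ofPred_eq] at hx hy ⊢
    omega

theorem iteratedDerivation_mem_supported_degree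
    (hδ : ∀ i x, δ i (X x) ∈ supported k {y | deg y = deg x + e i}) {s : List σ}
    (hs : ∀ i ∈ s, 0 < e i) {n : ℤ} {f : MvPolynomial ι k}
    (hf : f ∈ supported k {y | deg y ≤ n}) :
    iteratedDerivation δ s f ∈ supported k {y | deg y ≤ n + (s.map e).sum} := by
  induction s using List.reverseRecOn with
  | nil => simpa [iteratedDerivation] using hf
  | append_singleton s i ih =>
    rw [iteratedDerivation_concat]
    refine derivation_mem_supported_degree hδ (hs i (by simp)) ?_
      (ih fun j hj => hs j (by simp [hj]))
    simp [add_assoc]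

/-- Modulo polynomials in variables of degree smaller than the maximal possible one, an iterated
derivation of positive degree satisfies the chain rule of a derivation: in the other terms of the
Leibniz formula the derivations are distributed over several factors. -/
theorem iteratedDerivation_sub_sum_mem_supported
    (hδ : ∀ i x, δ i (X x) ∈ supported k {y | deg y = deg x + e i}) {s : List σ} (hne : s ≠ [])
    (hs : ∀ i ∈ s, 0 < e i) {n : ℤ} {f : MvPolynomial ι k}
    (hf : f ∈ supported k {y | deg y ≤ n}) :
    iteratedDerivation δ s f - ∑ x ∈ f.vars, pderiv x f * iteratedDerivation δ s (X x) ∈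
      supported k {y | deg y ≤ n + (s.map e).sum - 1} := by
  induction s using List.reverseRecOn with
  | nil => exact absurd rfl hne
  | append_singleton s i ih =>
    have hi := hs i (by simp)
    have hs' : ∀ j ∈ s, 0 < e j := fun j hj => hs j (by simp [hj])
    simp only [iteratedDerivation_concat]
    rcases eq_or_ne s [] with rfl | hs0
    · have h := derivation_eq_sum_pderiv (δ i) f
      simp only [iteratedDerivation, List.foldl_nil]
      rw [← h, sub_self]
      exact zero_mem _
    have hpos : 0 < (s.map e).sum :=
      List.sum_pos _ (by simpa using hs') (by simpa using hs0)
    have hsum : ((s ++ [i]).map e).sum = (s.map e).sum + e i := by simp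
    have key : δ i (iteratedDerivation δ s f) -
        ∑ x ∈ f.vars, pderiv x f * δ i (iteratedDerivation δ s (X x)) =
        δ i (iteratedDerivation δ s f -
          ∑ x ∈ f.vars, pderiv x f * iteratedDerivation δ s (X x)) +
        ∑ x ∈ f.vars, iteratedDerivation δ s (X x) * δ i (pderiv x f) := by
      rw [map_sub, map_sum]
      simp only [Derivation.leibniz, smul_eq_mul, Finset.sum_add_distrib]
      ring
    rw [key, hsum]
    refine add_mem (derivation_mem_supported_degree hδ hi (by omega) (ih hs0 hs'))
      (sum_mem fun x hx => mul_mem (supported_mono ?_ (iteratedDerivation_mem_supported_degree hδ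
        hs' ((X_mem_supported (s := {y | deg y ≤ n})).2 (mem_supported.1 hf hx)))) ?_)
    · intro y hy
      simp only [Set.mem_ofPred_eq] at hy ⊢
      omega
    · exact derivation_mem_supported_degree hδ hi (by omega)
        (mem_supported.2 (vars_pderiv_subset x (mem_supported.1 hf)))

/-- If an iterated derivation sends the variable `N` to `c K` plus terms in `U`, and all other
variables from `V` into `U`, then it sends a polynomial `f` in the variables `V` to
`c ∂f/∂N K` plus terms in `U`, provided `U` contains all variables of degree smaller than that
of `K`. -/
theorem iteratedDerivation_sub_mem_supported
    (hδ : ∀ i x, δ i (X x) ∈ supported k {y | deg y = deg x + e i}) {s : List σ} (hne : s ≠ [])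
    (hs : ∀ i ∈ s, 0 < e i) {n : ℤ} {U V : Set ι} (hVU : V ⊆ U) (hV : ∀ x ∈ V, deg x ≤ n)
    (hU : ∀ y, deg y < n + (s.map e).sum → y ∈ U) {N K : ι} {c : k}
    (hN : iteratedDerivation δ s (X N) - C c * X K ∈ supported k U)
    (hlt : ∀ x ∈ V, x ≠ N → iteratedDerivation δ s (X x) ∈ supported k U)
    {f : MvPolynomial ι k} (hf : f ∈ supported k V) :
    iteratedDerivation δ s f - C c * pderiv N f * X K ∈ supported k U := by
  classical
  have h1 := supported_mono (fun y hy => hU y (by simp only [Set.mem_ofPred_eq] at hy; omega))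
    (iteratedDerivation_sub_sum_mem_supported hδ hne hs (supported_mono hV hf))
  have h2 : ∑ x ∈ f.vars, pderiv x f * iteratedDerivation δ s (X x) - C c * pderiv N f * X K =
      ∑ x ∈ f.vars, pderiv x f *
        (iteratedDerivation δ s (X x) - if x = N then C c * X K else 0) := by
    simp only [mul_sub, Finset.sum_sub_distrib, mul_ite, mul_zero, Finset.sum_ite_eq']
    congr 1
    split_ifs with h
    · ring
    · rw [pderiv_eq_zero_of_notMem_vars h]; ring
  rw [← sub_add_sub_cancel _ (∑ x ∈ f.vars, pderiv x f * iteratedDerivation δ s (X x)), h2]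
  refine add_mem h1 (sum_mem fun x hx => mul_mem (mem_supported.2
    ((vars_pderiv_subset x (mem_supported.1 hf)).trans hVU)) ?_)
  split_ifs with h
  · exact h ▸ hN
  · simpa using hlt x (mem_supported.1 hf hx) h

end Degree

end MvPolynomial

/-! ### The Lie algebra and its symmetric algebra -/

namespace Dicksonian

open SymmetricAlgebra (poissonBracket equivMvPolynomial)

variable {k L ι : Type*} [Field k] [LieRing L] [LieAlgebra k L]

/-- The embedding of a Lie algebra as the linear forms in the polynomial ring on a basis. -/
def linearForm (b : Module.Basis ι k L) : L →ₗ[k] MvPolynomial ι k :=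
  (equivMvPolynomial b).toLinearMap ∘ₗ SymmetricAlgebra.ι k L

theorem linearForm_basis (b : Module.Basis ι k L) (i : ι) : linearForm b (b i) = X i := by
  simp [linearForm]

theorem linearForm_mem_supported (b : Module.Basis ι k L) {e : L} {V : Set ι}
    (h : ∀ x ∈ (b.repr e).support, x ∈ V) : linearForm b e ∈ supported k V := by
  rw [← b.linearCombination_repr e, Finsupp.linearCombination_apply, Finsupp.sum, map_sum]
  refine sum_mem fun x hx => ?_
  rw [map_smul, linearForm_basis]
  exact Subalgebra.smul_mem _ (X_mem_supported.2 (h x hx)) _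

/-- The derivation `{·, b i}` of the symmetric algebra, in terms of polynomials. -/
def bracketDerivation (b : Module.Basis ι k L) (i : ι) :
    Derivation k (MvPolynomial ι k) (MvPolynomial ι k) :=
  mkDerivation k fun x => linearForm b ⁅b x, b i⁆

theorem bracketDerivation_linearForm (b : Module.Basis ι k L) (i : ι) (e : L) :
    bracketDerivation b i (linearForm b e) = linearForm b ⁅e, b i⁆ := by
  rw [← b.linearCombination_repr e, Finsupp.linearCombination_apply, Finsupp.sum, map_sum, map_sum,
    sum_lie, map_sum]
  refine Finset.sum_congr rfl fun x _ => ?_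
  rw [map_smul, Derivation.map_smul, smul_lie, map_smul, linearForm_basis, bracketDerivation,
    mkDerivation_X]

theorem bracketDerivation_equiv (b : Module.Basis ι k L) (i : ι) (a : SymmetricAlgebra k L) :
    bracketDerivation b i (equivMvPolynomial b a) =
      -equivMvPolynomial b (poissonBracket k L (SymmetricAlgebra.ι k L (b i)) a) := by
  induction a using SymmetricAlgebra.induction with
  | algebraMap r => simp
  | ι x =>
    have := bracketDerivation_linearForm b i x
    simp only [linearForm, LinearMap.comp_apply, AlgEquiv.toLinearMap_apply] at this
    rw [this, SymmetricAlgebra.poissonBracket_ι_ι, ← lie_skew, map_neg, map_neg]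
  | mul x y hx hy => simp [hx, hy]; ring
  | add x y hx hy => simp [hx, hy]; ring

theorem iteratedDerivation_X (b : Module.Basis ι k L) (s : List ι) (x : ι) :
    iteratedDerivation (bracketDerivation b) s (X x) = linearForm b (iteratedBracket b s x) := by
  induction s using List.reverseRecOn with
  | nil => simp [iteratedDerivation, iteratedBracket, linearForm_basis]
  | append_singleton s i ih =>
    rw [iteratedDerivation_concat, ih, bracketDerivation_linearForm]
    simp [iteratedBracket]

/-- Radical Poisson ideals satisfy the ascending chain condition if the ideals of the polynomial
ring which are stable under bracketing with basis elements do. -/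
theorem accRadicalPoissonIdeals_of_basis (b : Module.Basis ι k L)
    (h : ∀ I : ℕ → Ideal (MvPolynomial ι k), Monotone I → (∀ n, (I n).IsRadical) →
      (∀ n, StableIdeal.IsStable (bracketDerivation b) (I n)) → ∃ n, ∀ m, n ≤ m → I m = I n) :
    SymmetricAlgebra.ACCRadicalPoissonIdeals k L := by
  intro I hI hIp
  let φ := equivMvPolynomial b
  obtain ⟨n, hn⟩ := h (fun n => (I n).comap φ.symm) (fun i j hij => Ideal.comap_mono (hI hij))
    (fun n => (hIp n).1.comap _) fun n i f hf => by
      obtain ⟨a, rfl⟩ := φ.surjective f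
      rw [Ideal.mem_comap, AlgEquiv.symm_apply_apply] at hf
      rw [bracketDerivation_equiv, Ideal.mem_comap, map_neg, AlgEquiv.symm_apply_apply]
      exact neg_mem ((hIp n).2 _ a hf)
  refine ⟨n, fun m hm => ?_⟩
  ext a
  have := congrArg (φ a ∈ ·) (hn m hm)
  simpa only [Ideal.mem_comap, AlgEquiv.symm_apply_apply, eq_iff_iff] using this

section Graded

variable {𝒜 : ℤ → Submodule k L} {b : Module.Basis ι k L} {deg : ι → ℤ}

theorem finite_setOf_degree_eq (hdeg : ∀ i, b i ∈ 𝒜 (deg i)) (n : ℤ) [FiniteDimensional k (𝒜 n)] :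
    {x | deg x = n}.Finite := by
  let v : {x | deg x = n} → 𝒜 n := fun x => ⟨b x, by simpa [show deg x = n from x.2] using hdeg x⟩
  have hv : LinearIndependent k v := LinearIndependent.of_comp (𝒜 n).subtype
    (b.linearIndependent.comp (Subtype.val : {x | deg x = n} → ι) Subtype.val_injective)
  have := hv.finite
  exact Set.toFinite _

theorem IsOrderedHomogeneous.degree_le [LinearOrder ι] (hb : IsOrderedHomogeneous 𝒜 b)
    (hdeg : ∀ i, b i ∈ 𝒜 (deg i)) {x y : ι} (h : x ≤ y) : deg x ≤ deg y :=
  not_lt.1 fun hlt => (hb.lt_of_degree_lt y x _ _ (hdeg y) (hdeg x) hlt).not_ge h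

/-- An ordered homogeneous basis is a locally finite order: only finitely many degrees occur in an
interval, and each of them only finitely often. -/
theorem IsOrderedHomogeneous.finite_Icc [LinearOrder ι] (hb : IsOrderedHomogeneous 𝒜 b)
    (hdeg : ∀ i, b i ∈ 𝒜 (deg i)) (hfin : ∀ n, FiniteDimensional k (𝒜 n)) (x y : ι) :
    (Set.Icc x y).Finite := by
  refine ((Set.finite_Icc (deg x) (deg y)).biUnion fun n _ =>
    finite_setOf_degree_eq hdeg n).subset fun z hz => ?_
  simp only [Set.mem_iUnion]
  exact ⟨deg z, ⟨hb.degree_le hdeg hz.1, hb.degree_le hdeg hz.2⟩, rfl⟩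

variable [GradedLieAlgebra 𝒜]

theorem degree_eq_of_mem_support (hdeg : ∀ i, b i ∈ 𝒜 (deg i)) {n : ℤ} {e : L} (he : e ∈ 𝒜 n)
    {x : ι} (hx : x ∈ (b.repr e).support) : deg x = n := by
  classical
  -- The part of `e` spanned by basis elements of other degrees vanishes, being homogeneous of
  -- degree `n` with trivial component in degree `n`.
  let p : ι → Prop := fun y => deg y = n
  set e₁ := b.repr.symm ((b.repr e).filter p) with he₁
  set e₂ := b.repr.symm ((b.repr e).filter fun y => ¬ p y) with he₂
  have hadd : e₁ + e₂ = e := by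
    rw [he₁, he₂, ← map_add, Finsupp.filter_add_filter_not, LinearEquiv.symm_apply_apply]
  have h₁ : e₁ ∈ 𝒜 n := by
    rw [he₁, Module.Basis.repr_symm_apply, Finsupp.linearCombination_apply, Finsupp.sum]
    refine sum_mem fun y hy => Submodule.smul_mem _ _ ?_
    rw [Finsupp.support_filter, Finset.mem_filter] at hy
    exact hy.2 ▸ hdeg y
  have h₂ : e₂ ∈ 𝒜 n := by
    rw [← hadd] at he
    exact (Submodule.add_mem_iff_right _ h₁).1 he
  have h₃ : (DirectSum.decompose 𝒜 e₂ n : L) = 0 := by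
    rw [he₂, Module.Basis.repr_symm_apply, Finsupp.linearCombination_apply, Finsupp.sum,
      DirectSum.decompose_sum, DFinsupp.finsetSum_apply, AddSubmonoidClass.coe_finsetSum]
    refine Finset.sum_eq_zero fun y hy => ?_
    rw [Finsupp.support_filter, Finset.mem_filter] at hy
    exact DirectSum.decompose_of_mem_ne 𝒜 (Submodule.smul_mem _ _ (hdeg y)) hy.2
  rw [DirectSum.decompose_of_mem_same 𝒜 h₂, he₂, LinearEquiv.map_eq_zero_iff] at h₃
  by_contra hne
  refine Finsupp.mem_support_iff.1 hx ?_
  have := DFunLike.congr_fun h₃ x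
  rwa [Finsupp.filter_apply_pos (fun y => ¬ p y) _ hne] at this

theorem iteratedBracket_mem (hdeg : ∀ i, b i ∈ 𝒜 (deg i)) (s : List ι) (x : ι) :
    iteratedBracket b s x ∈ 𝒜 (deg x + (s.map deg).sum) := by
  induction s using List.reverseRecOn with
  | nil => simpa [iteratedBracket] using hdeg x
  | append_singleton s i ih =>
    have := SetLike.GradedBracket.bracket_mem ih (hdeg i)
    simpa [iteratedBracket, add_assoc] using this

theorem degree_eq (hdeg : ∀ i, b i ∈ 𝒜 (deg i)) {i : ι} {n : ℤ} (h : b i ∈ 𝒜 n) : deg i = n :=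
  degree_eq_of_mem_support hdeg h (by simp)

theorem bracketDerivation_X_mem_supported (hdeg : ∀ i, b i ∈ 𝒜 (deg i)) (i x : ι) :
    bracketDerivation b i (X x) ∈ supported k {y | deg y = deg x + deg i} := by
  rw [← linearForm_basis b x, bracketDerivation_linearForm]
  exact linearForm_mem_supported b fun y hy => degree_eq_of_mem_support hdeg
    (SetLike.GradedBracket.bracket_mem (hdeg x) (hdeg i)) hy

theorem linearForm_iteratedBracket_sub_mem_supported {e : L} {U : Set ι} {K : ι}
    (h : ∀ x ∈ (b.repr e).support, x ≠ K → x ∈ U) :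
    linearForm b e - C (b.repr e K) * X K ∈ supported k U := by
  classical
  rw [← linearForm_basis b K, C_mul', ← map_smul, ← map_sub]
  refine linearForm_mem_supported b fun x hx => ?_
  rw [Finsupp.mem_support_iff] at hx
  have hxK : x ≠ K := by
    rintro rfl
    simp at hx
  refine h x (Finsupp.mem_support_iff.2 ?_) hxK
  simpa [Finsupp.single_apply, hxK.symm] using hx

variable [LinearOrder ι]

theorem upperProlongation_of_mem (hb : IsOrderedHomogeneous 𝒜 b) (hdeg : ∀ i, b i ∈ 𝒜 (deg i))
    {N K : ι} (hK : K ∈ upperLeadingSet 𝒜 b N) :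
    StableIdeal.UpperProlongation (bracketDerivation b) N K := by
  obtain ⟨s, hne, hs, hNK, hlt⟩ := hK
  have hs : ∀ i ∈ s, 0 < deg i := fun i hi => by
    obtain ⟨n, hn, hin⟩ := hs i hi
    rwa [degree_eq hdeg hin]
  have hlt' : ∀ x y, deg x < deg y → x < y := fun x y =>
    hb.lt_of_degree_lt x y _ _ (hdeg x) (hdeg y)
  have hKs : K ∈ (b.repr (iteratedBracket b s N)).support := Finset.mem_of_max hNK
  have hKdeg := degree_eq_of_mem_support hdeg (iteratedBracket_mem hdeg s N) hKs
  have hpos : 0 < (s.map deg).sum := List.sum_pos _ (by simpa using hs) (by simpa using hne)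
  have hNltK : N < K := hlt' _ _ (by omega)
  refine ⟨iteratedDerivation (bracketDerivation b) s,
    fun I hI f hf => iteratedDerivation_mem hI s hf, b.repr (iteratedBracket b s N) K,
    Finsupp.mem_support_iff.1 hKs, hNltK, fun M hMN f hf => ?_⟩
  have hmem₁ : iteratedDerivation (bracketDerivation b) s f -
      C (b.repr (iteratedBracket b s N) K) * pderiv N f * X K ∈ supported k (Set.Iio K) := by
    refine iteratedDerivation_sub_mem_supported (V := Set.Iic N) (n := deg N)
      (bracketDerivation_X_mem_supported hdeg) hne hs (Set.Iic_subset_Iio.2 hNltK)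
      (fun x hx => hb.degree_le hdeg hx) (fun y hy => hlt' _ _ (by omega)) ?_ ?_
      (supported_mono Set.Icc_subset_Iic_self hf)
    · rw [iteratedDerivation_X]
      exact linearForm_iteratedBracket_sub_mem_supported fun x hx hxK =>
        lt_of_le_of_ne (WithBot.coe_le_coe.1 ((Finset.le_max hx).trans_eq hNK)) hxK
    · intro x hxN hne
      rw [iteratedDerivation_X]
      refine linearForm_mem_supported b fun y hy => WithBot.coe_lt_coe.1 ?_
      have hle : (y : WithBot ι) ≤ upperD b s x := Finset.le_max hy
      rw [← hNK]
      exact hle.trans_lt (hlt x (lt_of_le_of_ne hxN hne) fun h => by simp [h] at hle)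
  have hmem₂ : iteratedDerivation (bracketDerivation b) s f -
      C (b.repr (iteratedBracket b s N) K) * pderiv N f * X K ∈ supported k (Set.Ici M) := by
    have hM : f ∈ supported k (Set.Ici M) := supported_mono Set.Icc_subset_Ici_self hf
    refine sub_mem (iteratedDerivation_mem_supported (fun i hi x hx => supported_mono
      (fun y hy => le_trans hx (hlt' x y ?_).le) (bracketDerivation_X_mem_supported hdeg i x)) hM)
      (mul_mem (mul_mem (Subalgebra.algebraMap_mem _ _)
        (mem_supported.2 (vars_pderiv_subset N (mem_supported.1 hM))))
        (X_mem_supported.2 (hMN.trans hNltK.le)))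
    have := hs i hi
    simp only [Set.mem_ofPred_eq] at hy
    omega
  rw [mem_supported] at hmem₁ hmem₂ ⊢
  exact fun x hx => ⟨hmem₂ hx, hmem₁ hx⟩

theorem lowerProlongation_of_mem (hb : IsOrderedHomogeneous 𝒜 b) (hdeg : ∀ i, b i ∈ 𝒜 (deg i))
    {M K : ι} (hK : K ∈ lowerLeadingSet 𝒜 b M) :
    StableIdeal.LowerProlongation (bracketDerivation b) M K := by
  obtain ⟨s, hne, hs, hMK, hlt⟩ := hK
  have hs : ∀ i ∈ s, 0 < -deg i := fun i hi => by
    obtain ⟨n, hn, hin⟩ := hs i hi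
    rw [degree_eq hdeg hin]
    omega
  have hlt' : ∀ x y, deg x < deg y → x < y := fun x y =>
    hb.lt_of_degree_lt x y _ _ (hdeg x) (hdeg y)
  have hδ : ∀ i x, bracketDerivation b i (X x) ∈
      supported k {y | (-deg y) = (-deg x) + (-deg i)} := fun i x =>
    supported_mono (fun y hy => by simp only [Set.mem_ofPred_eq] at hy ⊢; omega)
      (bracketDerivation_X_mem_supported hdeg i x)
  have hKs : K ∈ (b.repr (iteratedBracket b s M)).support := Finset.mem_of_min hMK
  have hKdeg := degree_eq_of_mem_support hdeg (iteratedBracket_mem hdeg s M) hKs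
  have hneg : (s.map fun i => -deg i).sum = -(s.map deg).sum := by
    rw [List.sum_neg, List.map_map]; rfl
  have hpos : 0 < (s.map fun i => -deg i).sum :=
    List.sum_pos _ (by simpa using hs) (by simpa using hne)
  have hKltM : K < M := hlt' _ _ (by omega)
  refine ⟨iteratedDerivation (bracketDerivation b) s,
    fun I hI f hf => iteratedDerivation_mem hI s hf, b.repr (iteratedBracket b s M) K,
    Finsupp.mem_support_iff.1 hKs, hKltM, fun N hMN f hf => ?_⟩
  have hmem₁ : iteratedDerivation (bracketDerivation b) s f -
      C (b.repr (iteratedBracket b s M) K) * pderiv M f * X K ∈ supported k (Set.Ioi K) := by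
    refine iteratedDerivation_sub_mem_supported (V := Set.Ici M) (n := -deg M)
      hδ hne hs (Set.Ici_subset_Ioi.2 hKltM)
      (fun x hx => neg_le_neg (hb.degree_le hdeg hx)) (fun y hy => hlt' _ _ (by omega)) ?_ ?_
      (supported_mono Set.Icc_subset_Ici_self hf)
    · rw [iteratedDerivation_X]
      exact linearForm_iteratedBracket_sub_mem_supported fun x hx hxK =>
        lt_of_le_of_ne (WithTop.coe_le_coe.1 (hMK.symm.trans_le (Finset.min_le hx))) hxK.symm
    · intro x hxM hne
      rw [iteratedDerivation_X]
      refine linearForm_mem_supported b fun y hy => WithTop.coe_lt_coe.1 ?_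
      have hle : lowerD b s x ≤ (y : WithTop ι) := Finset.min_le hy
      rw [← hMK]
      exact (hlt x (lt_of_le_of_ne hxM hne.symm) fun h => by simp [h] at hle).trans_le hle
  have hmem₂ : iteratedDerivation (bracketDerivation b) s f -
      C (b.repr (iteratedBracket b s M) K) * pderiv M f * X K ∈ supported k (Set.Iic N) := by
    have hN : f ∈ supported k (Set.Iic N) := supported_mono Set.Icc_subset_Iic_self hf
    refine sub_mem (iteratedDerivation_mem_supported (fun i hi x hx => supported_mono
      (fun y hy => le_trans (hlt' y x ?_).le hx) (bracketDerivation_X_mem_supported hdeg i x)) hN)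
      (mul_mem (mul_mem (Subalgebra.algebraMap_mem _ _)
        (mem_supported.2 (vars_pderiv_subset M (mem_supported.1 hN))))
        (X_mem_supported.2 (hKltM.le.trans hMN)))
    have := hs i hi
    simp only [Set.mem_ofPred_eq] at hy
    omega
  rw [mem_supported] at hmem₁ hmem₂ ⊢
  exact fun x hx => ⟨hmem₁ hx, hmem₂ hx⟩

theorem accRadicalPoissonIdeals_of_not_exists_seq [CharZero k]
    (hfin : ∀ n, FiniteDimensional k (𝒜 n)) (hb : IsOrderedHomogeneous 𝒜 b)
    (hseq : ¬ ∃ p : ℕ → ι × ι, IsLeadingDicksonianSeq 𝒜 b p) :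
    SymmetricAlgebra.ACCRadicalPoissonIdeals k L := by
  choose deg hdeg using hb.homogeneous
  let _ : LocallyFiniteOrder ι :=
    LocallyFiniteOrder.ofFiniteIcc (hb.finite_Icc hdeg hfin)
  refine accRadicalPoissonIdeals_of_basis b
    (StableIdeal.ascending_chain_condition_of_prolongations fun p hp hle => ?_)
  by_contra! hcon
  exact hseq ⟨p, hp, hle,
    fun i j hij hmem => (hcon i j hij).1 (lowerProlongation_of_mem hb hdeg hmem),
    fun i j hij hmem => (hcon i j hij).2 (upperProlongation_of_mem hb hdeg hmem)⟩

end Graded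

end Dicksonian

end

theorem theorem1p2 {k : Type*} {L : Type*} [Field k] [CharZero k] [LieRing L] [LieAlgebra k L]
    (𝒜 : ℤ → Submodule k L) [GradedLieAlgebra 𝒜] (hfin : ∀ n, FiniteDimensional k (𝒜 n))
    (hD : IsDicksonian 𝒜) :
    SymmetricAlgebra.ACCRadicalPoissonIdeals k L := by
  obtain ⟨s, _, b, -, hb, hseq⟩ := hD
  exact Dicksonian.accRadicalPoissonIdeals_of_not_exists_seq hfin hb hseq
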